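/- The category of limit cut complete MV-algebras and MV-algebra homomorphisms has all (small) coproducts. That is: for every set $I$ and every family $(A_i)_{i \in I}$ of limit cut complete MV-algebras there are a limit cut complete MV-algebra $A$ and homomorphisms $\mu_i : A_i \to A$ $(i\in I)$ such that for every limit cut complete MV-algebra $B$ and all homomorphisms $f_i : A_i \to B$ $(i\in I)$ there is exactly one homomorphism $f : A \to B$ with $f \circ \mu_i = f_i$ for all $i \in I$. Here an MV-algebra is a structure $(A, \oplus, {}^*, 0)$ such that $(A,\oplus,0)$ is a commutative monoid, $a^{**} = a$, $a \oplus 0^* = 0^*$ and $(a^* \oplus b)^* \oplus b = (b^* \oplus a)^* \oplus a$ for all $a, b \in A$. It is ordered by $a \le b \iff a^* \oplus b = 0^*$. An ideal is a downward closed submonoid of $(A,\oplus,0)$, and $\operatorname{Max} A$ is the set of the maximal elements among the proper ideals. $A$ is semisimple if $\bigcap \operatorname{Max} A = \{0\}$, where the empty intersection is $A$. The interval $[0,1]$ is an MV-algebra with $a \oplus b = \min\{1, a+b\}$ and $a^* = 1 - a$; for every $M \in \operatorname{Max} A$ there is exactly one homomorphism $\iota_M : A \to [0,1]$ with kernel $M$,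 and $\iota = (\iota_M)_{M} : A \to [0,1]^{\operatorname{Max} A}$ is the canonical map. A cut of $A$ is a pair $(X, Y)$ of subsets of $A$ such that $Y$ is the set of all upper bounds of $X$ and $X$ is the set of all lower bounds of $Y$. It is a limit cut if $\bigvee \iota[X] = \bigwedge \iota[Y]$ in $[0,1]^{\operatorname{Max} A}$, that is, pointwise. $A$ is limit cut complete if it is semisimple and, for every limit cut $(X,Y)$ of $A$, $\bigvee X$ and $\bigwedge Y$ exist in $A$ and are equal. -/

import Mathlib

universe u v

/-- An MV-algebra `(A, ⊕, *, 0)`: a commutative monoid with an involution `*` such that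
`a ⊕ 0* = 0*` and `(a* ⊕ b)* ⊕ b = (b* ⊕ a)* ⊕ a`. We write `a + b` for `a ⊕ b`, `aᶜ` for `a*`,
and the top element `1` is `0ᶜ`. The one-element algebra is allowed. -/
class MVAlgebra (A : Type u) extends AddCommMonoid A, Compl A where
  mv_compl_compl : ∀ a : A, aᶜᶜ = a
  mv_add_top : ∀ a : A, a + 0ᶜ = 0ᶜ
  mv_lukasiewicz : ∀ a b : A, (aᶜ + b)ᶜ + b = (bᶜ + a)ᶜ + a

/-- Homomorphisms of MV-algebras. -/
@[ext]
structure MVHom (A : Type u) (B : Type v) [MVAlgebra A] [MVAlgebra B] where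
  toFun : A → B
  map_zero : toFun 0 = 0
  map_add : ∀ a b : A, toFun (a + b) = toFun a + toFun b
  map_compl : ∀ a : A, toFun aᶜ = (toFun a)ᶜ

/-- The identity homomorphism. -/
def MVHom.id (A : Type u) [MVAlgebra A] : MVHom A A where
  toFun a := a
  map_zero := rfl
  map_add _ _ := rfl
  map_compl _ := rfl

/-- Composition of MV-algebra homomorphisms, first `f` and then `g`. -/
def MVHom.comp {A B C : Type u} [MVAlgebra A] [MVAlgebra B] [MVAlgebra C]
    (g : MVHom B C) (f : MVHom A B) : MVHom A C where
  toFun a := g.toFun (f.toFun a)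
  map_zero := by rw [f.map_zero, g.map_zero]
  map_add a b := by rw [f.map_add, g.map_add]
  map_compl a := by rw [f.map_compl, g.map_compl]

/-- The standard MV-algebra `[0,1]`, with `a ⊕ b = min 1 (a + b)` and `a* = 1 - a`. -/
noncomputable instance standardMVAlgebra : MVAlgebra unitInterval where
  zero := 0
  add a b := ⟨min 1 ((a : ℝ) + (b : ℝ)),
    le_min zero_le_one (add_nonneg a.2.1 b.2.1), min_le_left _ _⟩
  compl a := ⟨1 - (a : ℝ), by linarith [a.2.2], by linarith [a.2.1]⟩
  nsmul n a := ⟨min 1 ((n : ℝ) * (a : ℝ)),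
    le_min zero_le_one (mul_nonneg n.cast_nonneg a.2.1), min_le_left _ _⟩
  nsmul_zero := by
    rintro ⟨a, ha0, ha1⟩
    apply Subtype.ext
    change min 1 (((0 : ℕ) : ℝ) * a) = 0
    simp
  nsmul_succ := by
    rintro n ⟨a, ha0, ha1⟩
    apply Subtype.ext
    change min 1 (((n + 1 : ℕ) : ℝ) * a) = min 1 (min 1 ((n : ℝ) * a) + a)
    push_cast
    rw [add_mul, one_mul]
    grind
  add_assoc := by
    rintro ⟨a, ha0, ha1⟩ ⟨b, hb0, hb1⟩ ⟨c, hc0, hc1⟩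
    apply Subtype.ext
    change min 1 (min 1 (a + b) + c) = min 1 (a + min 1 (b + c))
    grind
  zero_add := by
    rintro ⟨a, ha0, ha1⟩
    apply Subtype.ext
    change min 1 (0 + a) = a
    grind
  add_zero := by
    rintro ⟨a, ha0, ha1⟩
    apply Subtype.ext
    change min 1 (a + 0) = a
    grind
  add_comm := by
    rintro ⟨a, ha0, ha1⟩ ⟨b, hb0, hb1⟩
    apply Subtype.ext
    change min 1 (a + b) = min 1 (b + a)
    grind
  mv_compl_compl := by
    rintro ⟨a, ha0, ha1⟩
    apply Subtype.ext
    change 1 - (1 - a) = a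
    ring
  mv_add_top := by
    rintro ⟨a, ha0, ha1⟩
    apply Subtype.ext
    change min 1 (a + (1 - 0)) = 1 - 0
    grind
  mv_lukasiewicz := by
    rintro ⟨a, ha0, ha1⟩ ⟨b, hb0, hb1⟩
    apply Subtype.ext
    change min 1 (1 - min 1 ((1 - a) + b) + b) = min 1 (1 - min 1 ((1 - b) + a) + a)
    grind

namespace MVAlgebra

variable {A : Type u} [MVAlgebra A]

/-- The natural order of an MV-algebra: `a ≤ b` iff `a* ⊕ b = 1`. -/
def le (a b : A) : Prop := aᶜ + b = 0ᶜ

/-- The set of upper bounds of `S` in the natural order. -/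
def upper (S : Set A) : Set A := {b | ∀ a ∈ S, le a b}

/-- The set of lower bounds of `S` in the natural order. -/
def lower (S : Set A) : Set A := {a | ∀ b ∈ S, le a b}

/-- `c` is the supremum of `S` in `A`. -/
def IsSup (S : Set A) (c : A) : Prop := c ∈ upper S ∧ ∀ b ∈ upper S, le c b

/-- `c` is the infimum of `S` in `A`. -/
def IsInf (S : Set A) (c : A) : Prop := c ∈ lower S ∧ ∀ a ∈ lower S, le a c

/-- Ideals: downward closed submonoids of `(A, ⊕, 0)`. -/
structure IsIdeal (I : Set A) : Prop where
  zero_mem : 0 ∈ I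
  add_mem : ∀ a ∈ I, ∀ b ∈ I, a + b ∈ I
  mem_of_le : ∀ a b : A, le a b → b ∈ I → a ∈ I

/-- Maximal ideals: maximal elements among the proper ideals. -/
structure IsMaximalIdeal (M : Set A) : Prop where
  isIdeal : IsIdeal M
  ne_univ : M ≠ Set.univ
  eq_of_le : ∀ I : Set A, IsIdeal I → I ≠ Set.univ → M ⊆ I → I = M

variable (A) in
/-- `A` is semisimple: the intersection of its maximal ideals is `{0}`. -/
def IsSemisimple : Prop := ∀ a : A, (∀ M : Set A, IsMaximalIdeal M → a ∈ M) → a = 0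

/-- The pair `(X, Y)` is a (Dedekind-MacNeille) cut of `A`. -/
structure IsCut (X Y : Set A) : Prop where
  upper_eq : upper X = Y
  lower_eq : lower Y = X

/-- A cut `(X, Y)` is a limit cut if `⋁ ι[X] = ⋀ ι[Y]` in `[0,1] ^ Max A`, where
`ι : A → [0,1] ^ Max A` is the canonical map. The `M`-th component of `ι` is the homomorphism
`A → A / M → [0,1]`, that is, the one homomorphism `φ : A → [0,1]` whose kernel is `M`.
Joins and meets in `[0,1] ^ Max A` are pointwise. -/
structure IsLimitCut (X Y : Set A) : Prop extends IsCut X Y where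
  sup_eq_inf : ∀ M : Set A, IsMaximalIdeal M →
    ∀ φ : MVHom A unitInterval, {a | φ.toFun a = 0} = M →
      ∃ r : unitInterval, IsLUB (φ.toFun '' X) r ∧ IsGLB (φ.toFun '' Y) r

variable (A) in
/-- `A` is limit cut complete: it is semisimple and `⋁ X = ⋀ Y` exists in `A` for every limit
cut `(X, Y)` of `A`. -/
structure IsLimitCutComplete : Prop where
  semisimple : IsSemisimple A
  complete : ∀ X Y : Set A, IsLimitCut X Y → ∃ c : A, IsSup X c ∧ IsInf Y c

end MVAlgebra

/-- Bundled MV-algebras. -/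
structure MVAlg : Type (u + 1) where
  carrier : Type u
  [str : MVAlgebra carrier]

attribute [instance] MVAlg.str

/-- The category of MV-algebras and MV-algebra homomorphisms. -/
instance MVAlg.category : CategoryTheory.Category.{u} MVAlg.{u} where
  Hom A B := MVHom A.carrier B.carrier
  id A := MVHom.id A.carrier
  comp f g := g.comp f

/-- The category of limit cut complete MV-algebras and all MV-algebra homomorphisms between
them: a full subcategory of the category of MV-algebras. -/
abbrev LccMVAlg : Type (u + 1) :=
  CategoryTheory.ObjectProperty.FullSubcategory
    (fun A : MVAlg.{u} => MVAlgebra.IsLimitCutComplete A.carrier)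

/-!
Coproducts of limit cut complete MV-algebras, built from homomorphisms to `[0,1]`.

A limit cut complete algebra `B` is semisimple, so by Hölder's theorem it is a separating algebra of
functions on the set `Hom(B, [0,1])`. Limit cut completeness says exactly that a `[0,1]`-valued
function on `Hom(B, [0,1])` which is both a pointwise supremum and a pointwise infimum of elements
of `B` is itself an element of `B` (`IsLimitCutComplete.exists_of_squeeze`).

For a family `(A_j)` let `S` be the set of all families of homomorphisms `s_j : A_j → [0,1]`. The
elements of the `A_j` are functions on `S`; let `A₀` be the algebra they generate in `[0,1]^S`. The
coproduct is the limit cut hull of `A₀` (`limitCutHull`): the functions on `S` that are both a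
pointwise supremum and a pointwise infimum of elements of `A₀`. It is limit cut complete because a
supremum of suprema is a supremum (`isLimitCutComplete_limitCutHull`). Homomorphisms `A_j → B` give
a map `Hom(B, [0,1]) → S`. Pulling back along it sends generators to elements of `B`, hence sends
`A₀` to `B`, and preserves pointwise suprema and infima, hence sends the hull to `B`
(`IsLimitCutComplete.exists_of_mem_limitCutHull`). Uniqueness holds because a homomorphism is
monotone, so its values on the hull are squeezed between its values on `A₀`
(`limitCutHull_hom_apply`). No topology on the spaces of homomorphisms is needed.

Hölder's theorem (`IsMaximalIdeal.exists_hom_ne_zero`) is proved by binary expansions. The quotient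
by a maximal ideal is an archimedean chain; the binary digits of `a` record whether `a ⊕ a` is the
top, and then one continues with `a ⊕ a` or `a ⊙ a`. The resulting real number `v(a)` satisfies
`v(a ⊕ b) = v(a) + v(b)` when `a ≤ b*`: the doubling recursion replaces a disjoint pair by another
one with twice the error, while errors are bounded.
-/

universe w

/-! ### Order and arithmetic of MV-algebras -/

namespace MVAlgebra

variable {A : Type u} [MVAlgebra A]

/-- Truncated difference `a ⊖ b = (a* ⊕ b)*`, the left adjoint of `b ⊕ ·`. In these terms the
product `a ⊙ b = (a* ⊕ b*)*` is `a ⊖ b*`. -/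
def diff (a b : A) : A := (aᶜ + b)ᶜ

@[simp] theorem compl_compl' (a : A) : aᶜᶜ = a := mv_compl_compl a

theorem compl_inj {a b : A} (h : aᶜ = bᶜ) : a = b := by
  rw [← compl_compl' a, h, compl_compl']

@[simp] theorem add_top (a : A) : a + 0ᶜ = 0ᶜ := mv_add_top a

@[simp] theorem top_add (a : A) : 0ᶜ + a = 0ᶜ := by rw [add_comm, add_top]

@[simp] theorem compl_add_self (a : A) : aᶜ + a = 0ᶜ := by
  have h := mv_lukasiewicz a 0ᶜ
  simpa using h.symm

theorem le_refl (a : A) : le a a := compl_add_self a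

theorem le_iff_exists {a b : A} : le a b ↔ ∃ c, b = a + c := by
  constructor
  · intro h
    have := mv_lukasiewicz a b
    rw [show aᶜ + b = 0ᶜ from h, compl_compl', zero_add] at this
    exact ⟨_, this.trans (add_comm _ _)⟩
  · rintro ⟨c, rfl⟩
    rw [le, ← add_assoc, compl_add_self, top_add]

theorem le_trans {a b c : A} (h : le a b) (h' : le b c) : le a c := by
  obtain ⟨d, rfl⟩ := le_iff_exists.1 h
  obtain ⟨e, rfl⟩ := le_iff_exists.1 h'
  exact le_iff_exists.2 ⟨d + e, by rw [add_assoc]⟩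

theorem le_antisymm {a b : A} (h : le a b) (h' : le b a) : a = b := by
  have := mv_lukasiewicz a b
  rw [show aᶜ + b = 0ᶜ from h, show bᶜ + a = 0ᶜ from h', compl_compl', zero_add, zero_add] at this
  exact this.symm

theorem le_add_right (a b : A) : le a (a + b) := le_iff_exists.2 ⟨b, rfl⟩

theorem le_add_left (a b : A) : le a (b + a) := le_iff_exists.2 ⟨b, add_comm _ _⟩

theorem zero_le (a : A) : le 0 a := le_iff_exists.2 ⟨a, (zero_add a).symm⟩

theorem le_top (a : A) : le a 0ᶜ := mv_add_top _

theorem add_le_add {a b c d : A} (h : le a b) (h' : le c d) : le (a + c) (b + d) := by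
  obtain ⟨x, rfl⟩ := le_iff_exists.1 h
  obtain ⟨y, rfl⟩ := le_iff_exists.1 h'
  exact le_iff_exists.2 ⟨x + y, by abel⟩

theorem le_compl_comm {a b : A} : le a bᶜ ↔ le b aᶜ := by
  rw [le, le, add_comm]

theorem compl_le_compl_iff {a b : A} : le aᶜ bᶜ ↔ le b a := by
  rw [le_compl_comm, compl_compl']

theorem add_eq_top_iff {a b : A} : a + b = 0ᶜ ↔ le aᶜ b := by
  rw [le, compl_compl']

theorem eq_zero_of_le_zero {a : A} (h : le a 0) : a = 0 := le_antisymm h (zero_le a)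

theorem eq_top_of_top_le {a : A} (h : le 0ᶜ a) : a = 0ᶜ := le_antisymm (le_top a) h

theorem diff_le_iff {a b c : A} : le (diff a b) c ↔ le a (b + c) := by
  rw [le, le, diff, compl_compl', add_assoc]

theorem le_add_diff (a b : A) : le a (b + diff a b) := diff_le_iff.1 (le_refl _)

theorem diff_le_self (a b : A) : le (diff a b) a := diff_le_iff.2 (le_add_left _ _)

theorem diff_eq_zero_iff {a b : A} : diff a b = 0 ↔ le a b :=
  ⟨fun h => by simpa [h] using le_add_diff a b,
    fun h => eq_zero_of_le_zero (diff_le_iff.2 (by simpa using h))⟩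

@[simp] theorem diff_zero (a : A) : diff a 0 = a := by simp [diff]

theorem diff_add (a b c : A) : diff a (b + c) = diff (diff a b) c := by
  simp [diff, add_assoc]

theorem diff_le_compl (a b : A) : le (diff a b) bᶜ := by
  rw [diff, compl_le_compl_iff]
  exact le_add_left _ _

theorem compl_diff_compl (a b : A) : diff aᶜ bᶜ = diff b a := by
  rw [diff, diff, compl_compl', add_comm]

theorem diff_add_cancel {a b : A} (h : le b a) : diff a b + b = a := by
  rw [diff, mv_lukasiewicz, show bᶜ + a = 0ᶜ from h, compl_compl', zero_add]

theorem add_diff_cancel {a b : A} (h : le a bᶜ) : diff (a + b) b = a := by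
  have := diff_add_cancel (le_compl_comm.1 h)
  rw [diff, compl_compl'] at this
  rw [diff, this, compl_compl']

theorem add_right_cancel_of_le {a b c : A} (ha : le a cᶜ) (hb : le b cᶜ) (h : a + c = b + c) :
    a = b := by
  rw [← add_diff_cancel ha, h, add_diff_cancel hb]

theorem diff_le_diff_add_diff (a b c : A) : le (diff a c) (diff a b + diff b c) := by
  rw [diff_le_iff]
  have h := add_le_add (le_add_diff b c) (le_refl (diff a b))
  exact le_trans (le_add_diff a b) (by rwa [add_assoc, add_comm (diff b c)] at h)

theorem add_diff_add_le (a b c d : A) : le (diff (a + b) (c + d)) (diff a c + diff b d) := by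
  rw [diff_le_iff]
  have h := add_le_add (le_add_diff a c) (le_add_diff b d)
  rwa [add_add_add_comm] at h

theorem diff_le_diff_right {a b : A} (h : le a b) (c : A) : le (diff a c) (diff b c) :=
  diff_le_iff.2 (le_trans h (le_add_diff b c))

theorem diff_le_diff_left {a b : A} (h : le a b) (c : A) : le (diff c b) (diff c a) :=
  diff_le_iff.2 (le_trans (le_add_diff c a) (add_le_add h (le_refl _)))

theorem add_diff_le {a b c : A} (hb : le b c) (ha : le a c) : le (b + diff a b) c := by
  have := add_le_add (le_refl b) (diff_le_diff_right ha b)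
  rwa [add_comm b (diff c b), diff_add_cancel hb] at this

theorem le_diff_diff {a b t : A} (ha : le t a) (hb : le t b) : le t (diff a (diff a b)) := by
  rw [diff, le_compl_comm, ← compl_diff_compl]
  exact add_diff_le (compl_le_compl_iff.2 ha) (compl_le_compl_iff.2 hb)

/-- Prelinearity: `a ⊖ b` and `b ⊖ a` have meet zero. -/
theorem eq_zero_of_le_diff_of_le_diff {a b t : A} (h : le t (diff a b)) (h' : le t (diff b a)) :
    t = 0 := by
  -- `d` is the meet of `a` and `b`; adding `t` to it stays below both.
  set d := diff a (diff a b)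
  have hda : le d a := diff_le_self _ _
  have hdb : le d b := diff_le_iff.2 (by
    have := le_add_diff a b
    rwa [add_comm] at this)
  have ht : le t (diff a d) := le_trans h (diff_le_diff_left hdb a)
  have ht' : le t (diff b d) := le_trans h' (diff_le_diff_left hda b)
  have h1 : le (t + d) d := by
    refine le_diff_diff ?_ ?_
    · have := add_le_add ht (le_refl d)
      rwa [diff_add_cancel hda] at this
    · have := add_le_add ht' (le_refl d)
      rwa [diff_add_cancel hdb] at this
  rw [← add_diff_cancel (le_trans ht (diff_le_compl a d)), diff_eq_zero_iff.2 h1]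

theorem diff_diff_swap (a b : A) : diff (diff b a) (diff a b) = diff b a := by
  refine le_antisymm (diff_le_self _ _) (diff_eq_zero_iff.1 ?_)
  refine eq_zero_of_le_diff_of_le_diff (a := a) (b := b) ?_ (diff_le_self _ _)
  rw [diff_le_iff, add_comm]
  exact le_add_diff _ _

theorem diff_nsmul_eq_self {a b : A} (h : diff b a = b) (n : ℕ) : diff b (n • a) = b := by
  induction n with
  | zero => simp
  | succ n ih => rw [succ_nsmul, diff_add, ih, h]

/-- An MV-algebra in which every nonzero element has a multiple equal to the top is totally
ordered: `a ⊖ b` and `b ⊖ a` have meet zero, so if one is nonzero, with a multiple equal to the top,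
then the other also has meet zero with the top. -/
theorem le_total_of_nsmul_eq_top (hA : ∀ a : A, a ≠ 0 → ∃ n : ℕ, n • a = 0ᶜ) (a b : A) :
    le a b ∨ le b a := by
  by_cases h : diff a b = 0
  · exact Or.inl (diff_eq_zero_iff.1 h)
  · obtain ⟨n, hn⟩ := hA _ h
    have := diff_nsmul_eq_self (diff_diff_swap a b) n
    rw [hn, diff_eq_zero_iff.2 (le_top _)] at this
    exact Or.inr (diff_eq_zero_iff.1 this.symm)

/-! ### The quotient by an ideal -/

/-- The congruence of an ideal `I`: `a ~ b` iff `a ⊖ b ∈ I` and `b ⊖ a ∈ I`. -/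
def idealCon {I : Set A} (hI : IsIdeal I) : AddCon A where
  r a b := diff a b ∈ I ∧ diff b a ∈ I
  iseqv :=
    { refl a := by
        rw [diff_eq_zero_iff.2 (le_refl a)]
        exact ⟨hI.zero_mem, hI.zero_mem⟩
      symm h := ⟨h.2, h.1⟩
      trans h h' :=
        ⟨hI.mem_of_le _ _ (diff_le_diff_add_diff _ _ _) (hI.add_mem _ h.1 _ h'.1),
          hI.mem_of_le _ _ (diff_le_diff_add_diff _ _ _) (hI.add_mem _ h'.2 _ h.2)⟩ }
  add' h h' :=
    ⟨hI.mem_of_le _ _ (add_diff_add_le _ _ _ _) (hI.add_mem _ h.1 _ h'.1),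
      hI.mem_of_le _ _ (add_diff_add_le _ _ _ _) (hI.add_mem _ h.2 _ h'.2)⟩

theorem idealCon_iff {I : Set A} (hI : IsIdeal I) {a b : A} :
    idealCon hI a b ↔ diff a b ∈ I ∧ diff b a ∈ I := Iff.rfl

/-- The quotient of an MV-algebra by an ideal. -/
instance idealQuotient {I : Set A} (hI : IsIdeal I) : MVAlgebra (idealCon hI).Quotient where
  compl := Quotient.map' (fun a => aᶜ) (by
    rintro a b ⟨h, h'⟩
    refine ⟨?_, ?_⟩ <;> rwa [compl_diff_compl])
  mv_compl_compl := by
    rintro ⟨a⟩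
    exact congrArg (AddCon.toQuotient (c := idealCon hI)) (mv_compl_compl a)
  mv_add_top := by
    rintro ⟨a⟩
    exact congrArg (AddCon.toQuotient (c := idealCon hI)) (mv_add_top a)
  mv_lukasiewicz := by
    rintro ⟨a⟩ ⟨b⟩
    exact congrArg (AddCon.toQuotient (c := idealCon hI)) (mv_lukasiewicz a b)

/-- The quotient map modulo an ideal. -/
def idealQuotientMk {I : Set A} (hI : IsIdeal I) : MVHom A (idealCon hI).Quotient where
  toFun a := (idealCon hI).mk' a
  map_zero := rfl
  map_add _ _ := rfl
  map_compl _ := rfl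

theorem idealQuotientMk_eq_zero_iff {I : Set A} (hI : IsIdeal I) {a : A} :
    (idealQuotientMk hI).toFun a = 0 ↔ a ∈ I := by
  refine (AddCon.eq (idealCon hI) (a := a) (b := 0)).trans ?_
  rw [idealCon_iff, diff_zero, diff_eq_zero_iff.2 (zero_le a)]
  exact and_iff_left hI.zero_mem

theorem IsIdeal.nsmul_mem {I : Set A} (hI : IsIdeal I) {a : A} (ha : a ∈ I) (n : ℕ) :
    n • a ∈ I := by
  induction n with
  | zero => simpa using hI.zero_mem
  | succ n ih => rw [succ_nsmul]; exact hI.add_mem _ ih _ ha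

/-- If `a` is not in the maximal ideal `M`, then the ideal generated by `M` and `a` contains the
top. -/
theorem IsMaximalIdeal.exists_add_nsmul_eq_top {M : Set A} (hM : IsMaximalIdeal M) {a : A}
    (ha : a ∉ M) : ∃ m ∈ M, ∃ n : ℕ, m + n • a = 0ᶜ := by
  let J : Set A := {x | ∃ m ∈ M, ∃ n : ℕ, le x (m + n • a)}
  have hJ : IsIdeal J :=
    { zero_mem := ⟨0, hM.isIdeal.zero_mem, 0, zero_le _⟩
      add_mem := by
        rintro x ⟨m, hm, n, h⟩ y ⟨m', hm', n', h'⟩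
        refine ⟨m + m', hM.isIdeal.add_mem _ hm _ hm', n + n', ?_⟩
        rw [add_nsmul, add_add_add_comm]
        exact add_le_add h h'
      mem_of_le := by
        rintro x y h ⟨m, hm, n, h'⟩
        exact ⟨m, hm, n, le_trans h h'⟩ }
  have hMJ : M ⊆ J := fun m hm => ⟨m, hm, 0, le_add_right _ _⟩
  have haJ : a ∈ J := ⟨0, hM.isIdeal.zero_mem, 1, by simpa using le_refl a⟩
  have hJ' : J = Set.univ := by
    by_contra h
    exact ha (hM.eq_of_le J hJ h hMJ ▸ haJ)
  obtain ⟨m, hm, n, h⟩ : (0ᶜ : A) ∈ J := hJ' ▸ Set.mem_univ _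
  exact ⟨m, hm, n, eq_top_of_top_le h⟩

end MVAlgebra

namespace MVHom

variable {A : Type u} {B : Type v} [MVAlgebra A] [MVAlgebra B]

theorem map_nsmul (f : MVHom A B) (n : ℕ) (a : A) : f.toFun (n • a) = n • f.toFun a := by
  induction n with
  | zero => simp [f.map_zero]
  | succ n ih => rw [succ_nsmul, succ_nsmul, f.map_add, ih]

theorem map_top (f : MVHom A B) : f.toFun 0ᶜ = 0ᶜ := by rw [f.map_compl, f.map_zero]

theorem map_le (f : MVHom A B) {a b : A} (h : MVAlgebra.le a b) :
    MVAlgebra.le (f.toFun a) (f.toFun b) := by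
  rw [MVAlgebra.le, ← f.map_compl, ← f.map_add, show aᶜ + b = 0ᶜ from h, f.map_top]

/-- Composition of homomorphisms between MV-algebras in arbitrary universes. -/
def compHom {C : Type w} [MVAlgebra C] (g : MVHom B C) (f : MVHom A B) : MVHom A C where
  toFun a := g.toFun (f.toFun a)
  map_zero := by rw [f.map_zero, g.map_zero]
  map_add a b := by rw [f.map_add, g.map_add]
  map_compl a := by rw [f.map_compl, g.map_compl]

end MVHom

namespace MVAlgebra

variable {A : Type u} [MVAlgebra A]

theorem IsMaximalIdeal.exists_nsmul_eq_top {M : Set A} (hM : IsMaximalIdeal M)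
    (x : (idealCon hM.isIdeal).Quotient) (hx : x ≠ 0) : ∃ n : ℕ, n • x = 0ᶜ := by
  obtain ⟨a, rfl⟩ : ∃ a, (idealQuotientMk hM.isIdeal).toFun a = x :=
    AddCon.mk'_surjective x
  obtain ⟨m, hm, n, h⟩ := hM.exists_add_nsmul_eq_top
    (fun ha => hx ((idealQuotientMk_eq_zero_iff hM.isIdeal).2 ha))
  refine ⟨n, ?_⟩
  have := congrArg (idealQuotientMk hM.isIdeal).toFun h
  rwa [MVHom.map_add, MVHom.map_nsmul, (idealQuotientMk_eq_zero_iff hM.isIdeal).2 hm, zero_add,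
    MVHom.map_top] at this

end MVAlgebra

/-! ### Binary expansions in archimedean chains -/

namespace MVAlgebra

variable {A : Type u} [MVAlgebra A]

open Classical in
/-- The first binary digit of `a`: it is `1` iff `a ⊕ a` is the top. -/
noncomputable def binaryDigit (a : A) : Fin 2 := if a + a = 0ᶜ then 1 else 0

open Classical in
/-- The analogue of `2 a - ⌊2 a⌋` (with value `1` at the top): `a ⊕ a` if this is not the top, and
`a ⊙ a` otherwise. -/
noncomputable def doubleMod (a : A) : A := if a + a = 0ᶜ then diff a aᶜ else a + a

/-- The real number whose binary digits are the first digits of the iterated doubles of `a`. -/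
noncomputable def binaryValue (a : A) : ℝ :=
  Real.ofDigits fun n => binaryDigit (doubleMod^[n] a)

theorem binaryValue_nonneg (a : A) : 0 ≤ binaryValue a := Real.ofDigits_nonneg _

theorem binaryValue_le_one (a : A) : binaryValue a ≤ 1 := Real.ofDigits_le_one _

theorem binaryValue_eq (a : A) :
    binaryValue a = ((binaryDigit a : ℕ) + binaryValue (doubleMod a)) / 2 := by
  have h := Real.ofDigits_eq_sum_add_ofDigits (fun n => binaryDigit (doubleMod^[n] a)) 1
  rw [binaryValue, h, binaryValue]
  simp [Real.ofDigitsTerm]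
  ring

theorem binaryValue_of_add_eq_top {a : A} (h : a + a = 0ᶜ) :
    binaryValue a = (1 + binaryValue (diff a aᶜ)) / 2 := by
  rw [binaryValue_eq, binaryDigit, doubleMod, if_pos h, if_pos h]
  simp

theorem binaryValue_of_add_ne_top {a : A} (h : a + a ≠ 0ᶜ) :
    binaryValue a = binaryValue (a + a) / 2 := by
  rw [binaryValue_eq, binaryDigit, doubleMod, if_neg h, if_neg h]
  simp

theorem binaryValue_zero (h : (0 : A) ≠ 0ᶜ) : binaryValue (0 : A) = 0 := by
  have := binaryValue_of_add_ne_top (a := (0 : A)) (by simpa using h)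
  rw [add_zero] at this
  linarith

theorem binaryValue_eq_half {a : A} (h : (0 : A) ≠ 0ᶜ) (ha : aᶜ = a) :
    binaryValue a = 1 / 2 := by
  have h1 : a + a = 0ᶜ := by
    nth_rw 1 [← ha]
    exact compl_add_self a
  rw [binaryValue_of_add_eq_top h1, ha, diff_eq_zero_iff.2 (le_refl a), binaryValue_zero h]
  norm_num

theorem abs_le_of_forall_le_div_two_pow {x y : ℝ} (h : ∀ n : ℕ, |x| ≤ y / 2 ^ n) : x = 0 := by
  have h1 : Filter.Tendsto (fun n : ℕ => y / (2 : ℝ) ^ n) Filter.atTop (nhds 0) :=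
    tendsto_const_nhds.div_atTop (tendsto_pow_atTop_atTop_of_one_lt one_lt_two)
  exact abs_eq_zero.1 (_root_.le_antisymm (ge_of_tendsto' h1 h) (abs_nonneg x))

variable (h0 : (0 : A) ≠ 0ᶜ) (htot : ∀ a b : A, le a b ∨ le b a)
include h0 htot

theorem binaryValue_compl (a : A) : binaryValue aᶜ = 1 - binaryValue a := by
  -- Both sides have the same doubling recursion, so each step halves the error.
  have key (n : ℕ) : ∀ a : A, |binaryValue aᶜ - (1 - binaryValue a)| ≤ 1 / 2 ^ n := by
    induction n with
    | zero =>
      intro a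
      have := binaryValue_nonneg a
      have := binaryValue_le_one a
      have := binaryValue_nonneg aᶜ
      have := binaryValue_le_one aᶜ
      rw [abs_le]
      constructor <;> norm_num <;> linarith
    | succ n ih =>
      intro a
      rw [pow_succ, ← div_div]
      by_cases h : a + a = 0ᶜ <;> by_cases h' : aᶜ + aᶜ = 0ᶜ
      · have ha : aᶜ = a := le_antisymm (add_eq_top_iff.1 h)
          (by simpa using add_eq_top_iff.1 h')
        rw [ha, binaryValue_eq_half h0 ha, sub_half, sub_self, abs_zero]
        positivity
      · have := ih (diff a aᶜ)
        rw [binaryValue_of_add_eq_top h, binaryValue_of_add_ne_top h', diff]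
        rw [diff, compl_compl'] at this
        rw [abs_le] at this ⊢
        constructor <;> linarith
      · have := ih (a + a)
        rw [binaryValue_of_add_ne_top h, binaryValue_of_add_eq_top h', diff, compl_compl']
        rw [abs_le] at this ⊢
        constructor <;> linarith
      · rcases htot a aᶜ with h1 | h1
        · exact absurd (add_eq_top_iff.2 (by simpa using h1)) h'
        · exact absurd (add_eq_top_iff.2 h1) h
  have := abs_le_of_forall_le_div_two_pow fun n => key n a
  linarith

omit h0 htot in
/-- If `a ≥ 1/2` and `a + b ≤ 1`, then `2 (a + b) - 1 = (2 a - 1) + 2 b`. -/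
theorem diff_compl_add_of_add_eq_top {a b : A} (ha : a + a = 0ᶜ) (hab : le a bᶜ) :
    diff (a + b) (a + b)ᶜ = diff a aᶜ + (b + b) := by
  have h1 : diff a aᶜ + aᶜ = a := diff_add_cancel (add_eq_top_iff.1 ha)
  have h2 : (a + b)ᶜ + b = aᶜ := by
    have := diff_add_cancel (le_compl_comm.1 hab)
    rwa [diff, compl_compl'] at this
  have h3 : le (a + b)ᶜ (a + b) :=
    le_trans (compl_le_compl_iff.2 (le_add_right a b))
      (le_trans (add_eq_top_iff.1 ha) (le_add_right a b))
  -- Both sides become `a + b` after adding `(a + b)ᶜ`.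
  refine add_right_cancel_of_le (c := (a + b)ᶜ) ?_ ?_ ?_
  · rw [compl_compl']
    exact diff_le_self _ _
  · rw [compl_compl', ← add_assoc]
    refine add_le_add ?_ (le_refl b)
    have := add_le_add (le_refl (diff a aᶜ)) (le_compl_comm.1 hab)
    rwa [h1] at this
  · rw [diff_add_cancel h3]
    calc a + b = diff a aᶜ + ((a + b)ᶜ + b) + b := by rw [h2, h1]
      _ = _ := by abel

omit h0 htot in
/-- If `b ≤ a ≤ 1/2`, then `2 (a + b) - 1 = 2 a + 2 b - 1` (truncated below at `0`). -/
theorem diff_compl_add_of_le {a b : A} (ha : le a aᶜ) (hba : le b a) :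
    diff (a + b) (a + b)ᶜ = diff (a + a) (b + b)ᶜ := by
  have hac : le aᶜ bᶜ := compl_le_compl_iff.2 hba
  have hab : le a bᶜ := le_trans ha hac
  have hbb : le b bᶜ := le_trans hba hab
  set e := (a + b)ᶜ with he
  -- With `e = 1 - a - b` and `d = a - b`, the complements of both sides equal `2 e`.
  have h2 : e + b = aᶜ := by
    have := diff_add_cancel (le_compl_comm.1 hab)
    rwa [diff, compl_compl'] at this
  have h2' : e + a = bᶜ := by
    have := diff_add_cancel hab
    rwa [diff, compl_compl', add_comm b a] at this
  have h3 : (a + a)ᶜ + a = aᶜ := by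
    have := diff_add_cancel ha
    rwa [diff, compl_compl'] at this
  have h4 : (b + b)ᶜ + b = bᶜ := by
    have := diff_add_cancel hbb
    rwa [diff, compl_compl'] at this
  have hd : diff a b + b = a := diff_add_cancel hba
  have hed : le (e + diff a b) bᶜ := by
    have := add_le_add (le_refl e) (diff_le_self a b)
    rwa [h2'] at this
  have h5 : (b + b)ᶜ = e + diff a b := by
    refine add_right_cancel_of_le (c := b) (compl_le_compl_iff.2 (le_add_right b b)) hed ?_
    rw [h4, add_assoc, hd, h2']
  have h6 : (a + a)ᶜ + diff a b = e := by
    refine add_right_cancel_of_le (c := b) ?_ (compl_le_compl_iff.2 (le_add_left b a)) ?_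
    · have := add_le_add (le_refl (a + a)ᶜ) (diff_le_self a b)
      rw [h3] at this
      exact le_trans this hac
    · rw [add_assoc, hd, h3, h2]
  apply compl_inj
  rw [diff, diff, compl_compl', compl_compl', h5, ← he]
  calc e + e = e + ((a + a)ᶜ + diff a b) := by rw [h6]
    _ = _ := by abel

theorem binaryValue_add {a b : A} (hab : le a bᶜ) :
    binaryValue (a + b) = binaryValue a + binaryValue b := by
  have hcompl := binaryValue_compl h0 htot
  have hle {x : A} (h : x + x ≠ 0ᶜ) : le x xᶜ :=
    (htot x xᶜ).resolve_right fun h' => h (add_eq_top_iff.2 h')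
  -- Doubling turns a disjoint pair into another disjoint pair with twice the error.
  have key (n : ℕ) : ∀ a b : A, le a bᶜ →
      |binaryValue (a + b) - (binaryValue a + binaryValue b)| ≤ 2 / 2 ^ n := by
    induction n with
    | zero =>
      intro a b _
      have := binaryValue_nonneg a
      have := binaryValue_le_one a
      have := binaryValue_nonneg b
      have := binaryValue_le_one b
      have := binaryValue_nonneg (a + b)
      have := binaryValue_le_one (a + b)
      rw [abs_le]
      constructor <;> norm_num <;> linarith
    | succ n ih =>
      have large {a b : A} (hab : le a bᶜ) (ha : a + a = 0ᶜ) (hb : b + b ≠ 0ᶜ) :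
          |binaryValue (a + b) - (binaryValue a + binaryValue b)| ≤ 2 / 2 ^ n / 2 := by
        have h1 : (a + b) + (a + b) = 0ᶜ := by
          rw [add_add_add_comm, ha, top_add]
        have := ih (diff a aᶜ) (b + b) (by
          rw [diff, compl_le_compl_iff]
          exact add_le_add (le_compl_comm.1 hab) (le_compl_comm.1 hab))
        rw [binaryValue_of_add_eq_top h1, binaryValue_of_add_eq_top ha,
          binaryValue_of_add_ne_top hb, diff_compl_add_of_add_eq_top ha hab]
        rw [abs_le] at this ⊢
        constructor <;> linarith
      have small {a b : A} (hba : le b a) (ha : a + a ≠ 0ᶜ) (hb : b + b ≠ 0ᶜ) :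
          |binaryValue (a + b) - (binaryValue a + binaryValue b)| ≤ 2 / 2 ^ n / 2 := by
        rw [binaryValue_of_add_ne_top ha, binaryValue_of_add_ne_top hb]
        by_cases h1 : (a + b) + (a + b) = 0ᶜ
        · -- `c = 2 a + 2 b - 1` is a summand of `2 b`, with complementary summand `1 - 2 a`.
          have h2 : le (b + b)ᶜ (a + a) := by
            rw [add_add_add_comm] at h1
            rw [← add_eq_top_iff, add_comm]
            exact h1
          have h3 := diff_add_cancel h2
          have := ih (diff (a + a) (b + b)ᶜ) (b + b)ᶜ (diff_le_compl _ _)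
          rw [h3, hcompl] at this
          rw [binaryValue_of_add_eq_top h1, diff_compl_add_of_le (hle ha) hba]
          rw [abs_le] at this ⊢
          constructor <;> linarith
        · have h2 : a + a + (b + b) ≠ 0ᶜ := by rwa [add_add_add_comm]
          have := ih (a + a) (b + b) ((htot _ _).resolve_right fun h =>
            h2 (by rw [add_comm]; exact add_eq_top_iff.2 h))
          rw [binaryValue_of_add_ne_top h1, add_add_add_comm]
          rw [abs_le] at this ⊢
          constructor <;> linarith
      intro a b hab
      rw [pow_succ, ← div_div]
      by_cases ha : a + a = 0ᶜ <;> by_cases hb : b + b = 0ᶜ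
      · have ha' := add_eq_top_iff.1 ha
        have hb' := add_eq_top_iff.1 hb
        have h1 : a = b := le_antisymm (le_trans hab hb')
          (le_trans (le_compl_comm.1 hab) ha')
        subst h1
        have h2 : aᶜ = a := le_antisymm ha' hab
        have h3 := hcompl 0
        rw [binaryValue_zero h0] at h3
        rw [ha, h3, binaryValue_eq_half h0 h2, sub_zero, add_halves, sub_self, abs_zero]
        positivity
      · exact large hab ha hb
      · rw [add_comm a b, add_comm (binaryValue a)]
        exact large (le_compl_comm.1 hab) hb ha
      · rcases htot b a with h | h
        · exact small h ha hb
        · rw [add_comm a b, add_comm (binaryValue a)]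
          exact small h hb ha
  have := abs_le_of_forall_le_div_two_pow fun n => key n a b hab
  linarith

theorem binaryValue_mono {a b : A} (hab : le a b) : binaryValue a ≤ binaryValue b := by
  have := binaryValue_add h0 htot (diff_le_compl b a)
  rw [diff_add_cancel hab] at this
  have := binaryValue_nonneg (diff b a)
  linarith

theorem binaryValue_add_eq_min (a b : A) :
    binaryValue (a + b) = min 1 (binaryValue a + binaryValue b) := by
  have hcompl := binaryValue_compl h0 htot
  rcases htot a bᶜ with h | h
  · rw [← binaryValue_add h0 htot h, min_eq_right (binaryValue_le_one _)]
  · have h1 := binaryValue_mono h0 htot h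
    have h2 := hcompl 0
    rw [binaryValue_zero h0] at h2
    rw [hcompl] at h1
    rw [add_comm a b, add_eq_top_iff.2 h, h2, min_eq_left (by linarith)]
    norm_num

omit h0 htot in
theorem binaryValue_ne_zero {a : A} {n : ℕ} (hn : n • a = 0ᶜ) : binaryValue a ≠ 0 := by
  -- If the value is zero then all digits vanish, so `2 ^ k • a` is never the top.
  have key (k : ℕ) : ∀ a : A, binaryValue a = 0 → (2 ^ k) • a ≠ 0ᶜ := by
    induction k with
    | zero =>
      intro a ha h
      rw [pow_zero, one_nsmul] at h
      have := binaryValue_of_add_eq_top (a := a) (by rw [h, top_add])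
      have := binaryValue_nonneg (diff a aᶜ)
      linarith
    | succ k ih =>
      intro a ha
      have h1 : a + a ≠ 0ᶜ := fun h => by
        have := binaryValue_of_add_eq_top h
        have := binaryValue_nonneg (diff a aᶜ)
        linarith
      have h2 := binaryValue_of_add_ne_top h1
      rw [pow_succ, mul_nsmul', two_nsmul]
      exact ih (a + a) (by linarith)
  intro ha
  refine key n a ha ?_
  obtain ⟨k, hk⟩ := Nat.exists_eq_add_of_le (Nat.lt_two_pow_self (n := n)).le
  rw [hk, add_nsmul, hn, top_add]

/-- The homomorphism to `[0,1]` given by binary expansions. -/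
noncomputable def binaryHom : MVHom A unitInterval where
  toFun a := ⟨binaryValue a, binaryValue_nonneg a, binaryValue_le_one a⟩
  map_zero := Subtype.ext (binaryValue_zero h0)
  map_add a b := Subtype.ext (binaryValue_add_eq_min h0 htot a b)
  map_compl a := Subtype.ext (binaryValue_compl h0 htot a)

omit h0 htot

/-- Hölder's theorem for MV-algebras: an element outside a maximal ideal is not killed by some
homomorphism to `[0,1]`. -/
theorem IsMaximalIdeal.exists_hom_ne_zero {M : Set A} (hM : IsMaximalIdeal M) {a : A}
    (ha : a ∉ M) : ∃ φ : MVHom A unitInterval, φ.toFun a ≠ 0 := by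
  set q := idealQuotientMk hM.isIdeal
  have hsimple := hM.exists_nsmul_eq_top
  have hqa : q.toFun a ≠ 0 := fun h => ha ((idealQuotientMk_eq_zero_iff hM.isIdeal).1 h)
  have h0 : (0 : (idealCon hM.isIdeal).Quotient) ≠ 0ᶜ := fun h =>
    hqa (eq_zero_of_le_zero (by rw [h]; exact le_top _))
  let ψ := binaryHom h0 (le_total_of_nsmul_eq_top hsimple)
  obtain ⟨n, hn⟩ := hsimple _ hqa
  exact ⟨ψ.compHom q, fun h => binaryValue_ne_zero hn (congrArg Subtype.val h)⟩

end MVAlgebra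

/-! ### Homomorphisms to the unit interval -/

namespace MVAlgebra

theorem le_unitInterval_iff {x y : unitInterval} : le x y ↔ (x : ℝ) ≤ y := by
  have h : le x y ↔ min 1 (1 - (x : ℝ) + y) = 1 - 0 := Subtype.ext_iff
  rw [h, sub_zero, min_eq_left_iff]
  constructor <;> intro h <;> linarith

variable {A : Type u} [MVAlgebra A]

/-- The kernel of a homomorphism to `[0,1]` is maximal, since some multiple of each nonzero element
of `[0,1]` is the top. -/
theorem isMaximalIdeal_ker (φ : MVHom A unitInterval) : IsMaximalIdeal {a | φ.toFun a = 0} where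
  isIdeal :=
    { zero_mem := φ.map_zero
      add_mem a ha b hb := by
        rw [Set.mem_ofPred_eq] at ha hb ⊢
        rw [φ.map_add, ha, hb, add_zero]
      mem_of_le a b h hb := by
        rw [Set.mem_ofPred_eq] at hb ⊢
        have := φ.map_le h
        rw [hb] at this
        exact eq_zero_of_le_zero this }
  ne_univ h := by
    have h1 : (0ᶜ : A) ∈ {a | φ.toFun a = 0} := by
      rw [h]
      exact Set.mem_univ _
    have h2 := congrArg Subtype.val (φ.map_top.symm.trans (Set.mem_ofPred_eq ▸ h1))
    have h3 : (1 : ℝ) - 0 = 0 := h2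
    norm_num at h3
  eq_of_le I hI hne hle := by
    refine (Set.Subset.antisymm hle fun a ha => ?_).symm
    by_contra h
    have h0 : (0 : ℝ) < φ.toFun a :=
      lt_of_le_of_ne (φ.toFun a).2.1 fun h' => h (Subtype.ext h'.symm)
    obtain ⟨n, hn⟩ := exists_nat_ge (1 / (φ.toFun a : ℝ))
    rw [div_le_iff₀ h0] at hn
    have h1 : φ.toFun (n • a) = 0ᶜ := by
      rw [φ.map_nsmul]
      refine Subtype.ext (show min 1 ((n : ℝ) * φ.toFun a) = 1 - 0 from ?_)
      rw [min_eq_left hn, sub_zero]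
    have h2 : (n • a)ᶜ ∈ I := hle (show φ.toFun (n • a)ᶜ = 0 by
      rw [φ.map_compl, h1, compl_compl'])
    have h3 := hI.add_mem _ h2 _ (hI.nsmul_mem ha n)
    rw [compl_add_self] at h3
    exact hne (Set.eq_univ_of_forall fun x => hI.mem_of_le _ _ (le_top x) h3)

theorem IsSemisimple.le_iff (hA : IsSemisimple A) {a b : A} :
    le a b ↔ ∀ φ : MVHom A unitInterval, (φ.toFun a : ℝ) ≤ φ.toFun b := by
  refine ⟨fun h φ => le_unitInterval_iff.1 (φ.map_le h), fun h => ?_⟩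
  rw [← diff_eq_zero_iff]
  refine hA _ fun M hM => ?_
  by_contra hab
  obtain ⟨φ, hφ⟩ := hM.exists_hom_ne_zero hab
  refine hφ ?_
  have : φ.toFun (diff a b) = diff (φ.toFun a) (φ.toFun b) := by
    rw [diff, φ.map_compl, φ.map_add, φ.map_compl, diff]
  rw [this, diff_eq_zero_iff]
  exact le_unitInterval_iff.2 (h φ)

theorem IsSemisimple.hom_ext (hA : IsSemisimple A) {a b : A}
    (h : ∀ φ : MVHom A unitInterval, φ.toFun a = φ.toFun b) : a = b :=
  le_antisymm (hA.le_iff.2 fun φ => by rw [h φ]) (hA.le_iff.2 fun φ => by rw [h φ])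

/-- In a limit cut complete algebra `A`, every function on the space of homomorphisms to `[0,1]`
that is both a pointwise supremum and a pointwise infimum of elements of `A` is itself given by an
element of `A`. -/
theorem IsLimitCutComplete.exists_of_squeeze (hA : IsLimitCutComplete A)
    (f : MVHom A unitInterval → unitInterval)
    (hf : ∀ φ : MVHom A unitInterval, ∀ ε : ℝ, 0 < ε → ∃ a b : A,
      (∀ ψ : MVHom A unitInterval, ψ.toFun a ≤ f ψ) ∧
      (∀ ψ : MVHom A unitInterval, f ψ ≤ ψ.toFun b) ∧ (φ.toFun b : ℝ) - φ.toFun a < ε) :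
    ∃ c : A, ∀ φ : MVHom A unitInterval, φ.toFun c = f φ := by
  set X : Set A := {a | ∀ ψ : MVHom A unitInterval, ψ.toFun a ≤ f ψ}
  set Y : Set A := {b | ∀ ψ : MVHom A unitInterval, f ψ ≤ ψ.toFun b}
  have hlub (φ : MVHom A unitInterval) : IsLUB (φ.toFun '' X) (f φ) := by
    refine ⟨?_, fun r hr => ?_⟩
    · rintro _ ⟨a, ha, rfl⟩
      exact ha φ
    · by_contra! hlt
      obtain ⟨a, b, ha, hb, hab⟩ := hf φ (f φ - r) (sub_pos.2 hlt)
      have h1 : (φ.toFun a : ℝ) ≤ r := hr ⟨a, ha, rfl⟩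
      have h2 : (f φ : ℝ) ≤ φ.toFun b := hb φ
      linarith
  have hglb (φ : MVHom A unitInterval) : IsGLB (φ.toFun '' Y) (f φ) := by
    refine ⟨?_, fun r hr => ?_⟩
    · rintro _ ⟨a, ha, rfl⟩
      exact ha φ
    · by_contra! hlt
      obtain ⟨a, b, ha, hb, hab⟩ := hf φ (r - f φ) (sub_pos.2 hlt)
      have h1 : (r : ℝ) ≤ φ.toFun b := hr ⟨b, hb, rfl⟩
      have h2 : (φ.toFun a : ℝ) ≤ f φ := ha φ
      linarith
  have hcut : IsLimitCut X Y :=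
    { upper_eq := by
        ext b
        constructor
        · intro hb φ
          refine (hlub φ).2 ?_
          rintro _ ⟨a, ha, rfl⟩
          exact hA.semisimple.le_iff.1 (hb a ha) φ
        · intro hb a ha
          exact hA.semisimple.le_iff.2 fun φ => (ha φ).trans (hb φ)
      lower_eq := by
        ext a
        constructor
        · intro ha φ
          refine (hglb φ).2 ?_
          rintro _ ⟨b, hb, rfl⟩
          exact hA.semisimple.le_iff.1 (ha b hb) φ
        · intro ha b hb
          exact hA.semisimple.le_iff.2 fun φ => (ha φ).trans (hb φ)
      sup_eq_inf := fun _ _ φ _ => ⟨f φ, hlub φ, hglb φ⟩ }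
  obtain ⟨c, hX, hY⟩ := hA.complete X Y hcut
  refine ⟨c, fun φ => _root_.le_antisymm ((hglb φ).2 ?_) ((hlub φ).2 ?_)⟩
  · rintro _ ⟨b, hb, rfl⟩
    exact hA.semisimple.le_iff.1 (hY.1 b hb) φ
  · rintro _ ⟨a, ha, rfl⟩
    exact hA.semisimple.le_iff.1 (hX.1 a ha) φ

/-! ### The limit cut hull of a set of functions -/

/-- Products of MV-algebras. -/
instance piMVAlgebra (S : Type v) : MVAlgebra (S → A) where
  mv_compl_compl a := funext fun s => mv_compl_compl (a s)
  mv_add_top a := funext fun s => mv_add_top (a s)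
  mv_lukasiewicz a b := funext fun s => mv_lukasiewicz (a s) (b s)

/-- Membership in the subalgebra generated by `G`. -/
inductive Generated (G : Set A) : A → Prop
  | of {a : A} : a ∈ G → Generated G a
  | zero : Generated G 0
  | add {a b : A} : Generated G a → Generated G b → Generated G (a + b)
  | compl {a : A} : Generated G a → Generated G aᶜ

variable {S : Type v}

/-- The limit cut hull of a set `G` of functions `S → [0,1]`: all functions that are both a
pointwise supremum and a pointwise infimum of elements of the subalgebra generated by `G`. For each
point and each `ε` one asks for a lower and an upper bound from that subalgebra which differ by
less than `ε` at this point. -/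
noncomputable def limitCutHull (G : Set (S → unitInterval)) : AddSubmonoid (S → unitInterval) where
  carrier := {f | ∀ s : S, ∀ ε : ℝ, 0 < ε → ∃ a b : S → unitInterval, Generated G a ∧
    Generated G b ∧ (∀ t, a t ≤ f t) ∧ (∀ t, f t ≤ b t) ∧ (b s : ℝ) - a s < ε}
  zero_mem' := fun s ε hε => ⟨0, 0, .zero, .zero, fun _ => le_rfl, fun _ => le_rfl, by simpa⟩
  add_mem' := by
    intro f g hf hg s ε hε
    obtain ⟨a, b, ha, hb, haf, hbf, hab⟩ := hf s (ε / 2) (half_pos hε)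
    obtain ⟨a', b', ha', hb', haf', hbf', hab'⟩ := hg s (ε / 2) (half_pos hε)
    refine ⟨a + a', b + b', ha.add ha', hb.add hb', fun t => ?_, fun t => ?_, ?_⟩
    · exact min_le_min_left 1 (_root_.add_le_add (α := ℝ) (haf t) (haf' t))
    · exact min_le_min_left 1 (_root_.add_le_add (α := ℝ) (hbf t) (hbf' t))
    · have h1 : (a s : ℝ) ≤ b s := (haf s).trans (hbf s)
      have h2 : (a' s : ℝ) ≤ b' s := (haf' s).trans (hbf' s)
      change min 1 ((b s : ℝ) + b' s) - min 1 ((a s : ℝ) + a' s) < ε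
      grind

theorem Generated.mem_limitCutHull {G : Set (S → unitInterval)} {f : S → unitInterval}
    (hf : Generated G f) : f ∈ limitCutHull G :=
  fun _ _ hε => ⟨f, f, hf, hf, fun _ => le_rfl, fun _ => le_rfl, by simpa⟩

theorem compl_mem_limitCutHull {G : Set (S → unitInterval)} {f : S → unitInterval}
    (hf : f ∈ limitCutHull G) : fᶜ ∈ limitCutHull G := by
  intro s ε hε
  obtain ⟨a, b, ha, hb, haf, hbf, hab⟩ := hf s ε hε
  refine ⟨bᶜ, aᶜ, hb.compl, ha.compl, fun t => ?_, fun t => ?_, ?_⟩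
  · exact sub_le_sub_left (α := ℝ) (hbf t) 1
  · exact sub_le_sub_left (α := ℝ) (haf t) 1
  · change (1 - (a s : ℝ)) - (1 - (b s : ℝ)) < ε
    linarith

noncomputable instance limitCutHullMVAlgebra (G : Set (S → unitInterval)) :
    MVAlgebra (limitCutHull G) where
  compl f := ⟨f.1ᶜ, compl_mem_limitCutHull f.2⟩
  mv_compl_compl a := Subtype.ext (mv_compl_compl a.1)
  mv_add_top a := Subtype.ext (mv_add_top a.1)
  mv_lukasiewicz a b := Subtype.ext (mv_lukasiewicz a.1 b.1)

/-- Evaluation at a point, a homomorphism. -/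
noncomputable def limitCutHullEval (G : Set (S → unitInterval)) (s : S) :
    MVHom (limitCutHull G) unitInterval where
  toFun f := f.1 s
  map_zero := rfl
  map_add _ _ := rfl
  map_compl _ := rfl

theorem limitCutHull_le_iff {G : Set (S → unitInterval)} {f g : limitCutHull G} :
    le f g ↔ ∀ s, f.1 s ≤ g.1 s := by
  refine ⟨fun h s => le_unitInterval_iff.1 ((limitCutHullEval G s).map_le h), fun h => ?_⟩
  exact Subtype.ext (funext fun s => le_unitInterval_iff.2 (h s))

theorem isLimitCutComplete_limitCutHull (G : Set (S → unitInterval)) :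
    IsLimitCutComplete (limitCutHull G) where
  semisimple f hf := Subtype.ext (funext fun s => hf _ (isMaximalIdeal_ker (limitCutHullEval G s)))
  complete X Y h := by
    -- Since evaluations have maximal kernels, the supremum and infimum agree at every point.
    choose r hX hY using fun s =>
      h.sup_eq_inf _ (isMaximalIdeal_ker (limitCutHullEval G s)) (limitCutHullEval G s) rfl
    have hXr {f : limitCutHull G} (hf : f ∈ X) (s : S) : f.1 s ≤ r s := (hX s).1 ⟨f, hf, rfl⟩
    have hYr {f : limitCutHull G} (hf : f ∈ Y) (s : S) : r s ≤ f.1 s := (hY s).1 ⟨f, hf, rfl⟩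
    have hr : r ∈ limitCutHull G := by
      intro s ε hε
      have h4 : 0 < ε / 4 := by positivity
      obtain ⟨x, hx, hxs⟩ : ∃ x ∈ X, (r s : ℝ) - ε / 4 < x.1 s := by
        by_contra! hcon
        obtain ⟨x, hx⟩ : X.Nonempty := by
          refine ⟨0, ?_⟩
          rw [← h.lower_eq]
          exact fun b _ => zero_le b
        have hnn : 0 ≤ (r s : ℝ) - ε / 4 := (x.1 s).2.1.trans (hcon x hx)
        have h1 : r s ≤ ⟨(r s : ℝ) - ε / 4, hnn, by linarith [(r s).2.2]⟩ := by
          refine (hX s).2 ?_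
          rintro _ ⟨y, hy, rfl⟩
          exact hcon y hy
        have h2 : (r s : ℝ) ≤ r s - ε / 4 := h1
        linarith
      obtain ⟨y, hy, hys⟩ : ∃ y ∈ Y, (y.1 s : ℝ) < r s + ε / 4 := by
        by_contra! hcon
        obtain ⟨y, hy⟩ : Y.Nonempty := by
          refine ⟨0ᶜ, ?_⟩
          rw [← h.upper_eq]
          exact fun b _ => le_top b
        have hle : (r s : ℝ) + ε / 4 ≤ 1 := (hcon y hy).trans (y.1 s).2.2
        have h1 : (⟨(r s : ℝ) + ε / 4, by linarith [(r s).2.1], hle⟩ : unitInterval) ≤ r s := by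
          refine (hY s).2 ?_
          rintro _ ⟨z, hz, rfl⟩
          exact hcon z hz
        have h2 : (r s : ℝ) + ε / 4 ≤ r s := h1
        linarith
      obtain ⟨a, b, ha, -, hax, hbx, hab⟩ := x.2 s (ε / 4) h4
      obtain ⟨a', b', -, hb', hay, hby, hab'⟩ := y.2 s (ε / 4) h4
      refine ⟨a, b', ha, hb', fun t => (hax t).trans (hXr hx t),
        fun t => (hYr hy t).trans (hby t), ?_⟩
      have h1 : (x.1 s : ℝ) ≤ b s := hbx s
      have h2 : (a' s : ℝ) ≤ y.1 s := hay s
      linarith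
    refine ⟨⟨r, hr⟩, ⟨fun f hf => ?_, fun f hf => ?_⟩, ⟨fun f hf => ?_, fun f hf => ?_⟩⟩
    · exact limitCutHull_le_iff.2 (hXr hf)
    · rw [h.upper_eq] at hf
      exact limitCutHull_le_iff.2 (hYr hf)
    · exact limitCutHull_le_iff.2 (hYr hf)
    · rw [h.lower_eq] at hf
      exact limitCutHull_le_iff.2 (hXr hf)

variable {G : Set (S → unitInterval)} {B : Type u} [MVAlgebra B]

/-- If pulling back along `h` sends the elements of `G` to elements of `B`, then it sends the
elements of the limit cut hull of `G` to elements of `B`. -/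
theorem IsLimitCutComplete.exists_of_mem_limitCutHull (hB : IsLimitCutComplete B)
    (h : MVHom B unitInterval → S)
    (hG : ∀ f ∈ G, ∃ c : B, ∀ φ : MVHom B unitInterval, φ.toFun c = f (h φ))
    {f : S → unitInterval} (hf : f ∈ limitCutHull G) :
    ∃ c : B, ∀ φ : MVHom B unitInterval, φ.toFun c = f (h φ) := by
  have hgen {f : S → unitInterval} (hf : Generated G f) :
      ∃ c : B, ∀ φ : MVHom B unitInterval, φ.toFun c = f (h φ) := by
    induction hf with
    | of hf => exact hG _ hf
    | zero => exact ⟨0, fun φ => φ.map_zero⟩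
    | add _ _ ih ih' =>
      obtain ⟨c, hc⟩ := ih
      obtain ⟨c', hc'⟩ := ih'
      exact ⟨c + c', fun φ => by rw [φ.map_add, hc, hc']; rfl⟩
    | compl _ ih =>
      obtain ⟨c, hc⟩ := ih
      exact ⟨cᶜ, fun φ => by rw [φ.map_compl, hc]; rfl⟩
  refine hB.exists_of_squeeze (fun φ => f (h φ)) fun φ ε hε => ?_
  obtain ⟨a, b, ha, hb, haf, hbf, hab⟩ := hf (h φ) ε hε
  obtain ⟨c, hc⟩ := hgen ha
  obtain ⟨d, hd⟩ := hgen hb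
  refine ⟨c, d, fun ψ => ?_, fun ψ => ?_, ?_⟩
  · rw [hc]
    exact haf _
  · rw [hd]
    exact hbf _
  · rwa [hc, hd]

/-- The homomorphism from the limit cut hull to `B` induced by `h`. -/
noncomputable def limitCutHullLift (hB : IsLimitCutComplete B) (h : MVHom B unitInterval → S)
    (hG : ∀ f ∈ G, ∃ c : B, ∀ φ : MVHom B unitInterval, φ.toFun c = f (h φ)) :
    MVHom (limitCutHull G) B where
  toFun f := (hB.exists_of_mem_limitCutHull h hG f.2).choose
  map_zero := hB.semisimple.hom_ext fun φ => by
    rw [(hB.exists_of_mem_limitCutHull h hG (0 : limitCutHull G).2).choose_spec φ, φ.map_zero]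
    rfl
  map_add f g := hB.semisimple.hom_ext fun φ => by
    rw [(hB.exists_of_mem_limitCutHull h hG (f + g).2).choose_spec φ, φ.map_add,
      (hB.exists_of_mem_limitCutHull h hG f.2).choose_spec φ,
      (hB.exists_of_mem_limitCutHull h hG g.2).choose_spec φ]
    rfl
  map_compl f := hB.semisimple.hom_ext fun φ => by
    rw [(hB.exists_of_mem_limitCutHull h hG fᶜ.2).choose_spec φ, φ.map_compl,
      (hB.exists_of_mem_limitCutHull h hG f.2).choose_spec φ]
    rfl

theorem apply_limitCutHullLift (hB : IsLimitCutComplete B) (h : MVHom B unitInterval → S)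
    (hG : ∀ f ∈ G, ∃ c : B, ∀ φ : MVHom B unitInterval, φ.toFun c = f (h φ))
    (f : limitCutHull G) (φ : MVHom B unitInterval) :
    φ.toFun ((limitCutHullLift hB h hG).toFun f) = f.1 (h φ) :=
  (hB.exists_of_mem_limitCutHull h hG f.2).choose_spec φ

/-- After composition with homomorphisms to `[0,1]`, a homomorphism from the limit cut hull of `G`
is determined by its values on `G`: the image of an element of the hull is squeezed between the
images of elements of the generated subalgebra. -/
theorem limitCutHull_hom_apply (h : MVHom B unitInterval → S)
    {g : MVHom (limitCutHull G) B}
    (hg : ∀ f (hf : f ∈ G), ∀ φ : MVHom B unitInterval,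
      φ.toFun (g.toFun ⟨f, (Generated.of hf).mem_limitCutHull⟩) = f (h φ))
    (f : limitCutHull G) (φ : MVHom B unitInterval) :
    φ.toFun (g.toFun f) = f.1 (h φ) := by
  have hgen {f : S → unitInterval} (hf : Generated G f) :
      φ.toFun (g.toFun ⟨f, hf.mem_limitCutHull⟩) = f (h φ) := by
    induction hf with
    | of hf => exact hg _ hf φ
    | zero => exact (φ.compHom g).map_zero
    | add ha hb ih ih' =>
      refine ((φ.compHom g).map_add ⟨_, ha.mem_limitCutHull⟩ ⟨_, hb.mem_limitCutHull⟩).trans ?_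
      exact congrArg₂ (· + ·) ih ih'
    | compl ha ih =>
      refine ((φ.compHom g).map_compl ⟨_, ha.mem_limitCutHull⟩).trans ?_
      exact congrArg compl ih
  have key : |(φ.toFun (g.toFun f) : ℝ) - f.1 (h φ)| ≤ 0 := by
    refine le_of_forall_pos_le_add fun ε hε => ?_
    obtain ⟨a, b, ha, hb, haf, hbf, hab⟩ := f.2 (h φ) ε hε
    have h1 := le_unitInterval_iff.1 ((φ.compHom g).map_le
      (limitCutHull_le_iff (f := ⟨a, ha.mem_limitCutHull⟩) (g := f) |>.2 haf))
    have h2 := le_unitInterval_iff.1 ((φ.compHom g).map_le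
      (limitCutHull_le_iff (f := f) (g := ⟨b, hb.mem_limitCutHull⟩) |>.2 hbf))
    change (φ.toFun (g.toFun ⟨a, ha.mem_limitCutHull⟩) : ℝ) ≤ φ.toFun (g.toFun f) at h1
    change (φ.toFun (g.toFun f) : ℝ) ≤ φ.toFun (g.toFun ⟨b, hb.mem_limitCutHull⟩) at h2
    rw [hgen ha] at h1
    rw [hgen hb] at h2
    have h3 : (a (h φ) : ℝ) ≤ f.1 (h φ) := haf _
    have h4 : (f.1 (h φ) : ℝ) ≤ b (h φ) := hbf _
    rw [abs_le]
    constructor <;> linarith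
  exact Subtype.ext (sub_eq_zero.1 (abs_nonpos_iff.1 key))

end MVAlgebra

/-! ### Coproducts -/

open MVAlgebra CategoryTheory Limits

namespace LccMVAlg

variable {J : Type u} (F : J → LccMVAlg.{u})

/-- The elements of the algebras `F j`, as functions on the families of homomorphisms
`F j → [0,1]`. These families are the homomorphisms to `[0,1]` from the coproduct of the `F j`. -/
def coproductGenerators : Set ((∀ j, MVHom (F j).obj.carrier unitInterval) → unitInterval) :=
  {f | ∃ j a, f = fun s => (s j).toFun a}

/-- The coproduct injections. -/
noncomputable def coproductInjection (j : J) :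
    MVHom (F j).obj.carrier (limitCutHull (coproductGenerators F)) where
  toFun a := ⟨fun s => (s j).toFun a,
    (Generated.of (G := coproductGenerators F) ⟨j, a, rfl⟩).mem_limitCutHull⟩
  map_zero := Subtype.ext (funext fun s => (s j).map_zero)
  map_add a b := Subtype.ext (funext fun s => (s j).map_add a b)
  map_compl a := Subtype.ext (funext fun s => (s j).map_compl a)

/-- The coproduct cofan. -/
noncomputable def coproductCofan : Cofan F :=
  Cofan.mk
    (⟨⟨limitCutHull (coproductGenerators F)⟩, isLimitCutComplete_limitCutHull _⟩ : LccMVAlg.{u})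
    fun j => ObjectProperty.homMk (coproductInjection F j)

variable {F} in
theorem exists_of_mem_coproductGenerators {B : Type u} [MVAlgebra B]
    (g : ∀ j, MVHom (F j).obj.carrier B) :
    ∀ f ∈ coproductGenerators F, ∃ c : B, ∀ φ : MVHom B unitInterval,
      φ.toFun c = f fun j => φ.compHom (g j) := by
  rintro _ ⟨j, a, rfl⟩
  exact ⟨(g j).toFun a, fun _ => rfl⟩

variable {F} in
/-- The homomorphism from the coproduct with given restrictions. It sends `f` to the element of `B`
whose value under each `φ : B → [0,1]` is the value of `f` at the family of the `φ ∘ g j`. -/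
noncomputable def coproductDesc {B : Type u} [MVAlgebra B] (hB : IsLimitCutComplete B)
    (g : ∀ j, MVHom (F j).obj.carrier B) : MVHom (limitCutHull (coproductGenerators F)) B :=
  limitCutHullLift hB (fun φ j => φ.compHom (g j)) (exists_of_mem_coproductGenerators g)

variable {F} in
theorem apply_coproductDesc {B : Type u} [MVAlgebra B] (hB : IsLimitCutComplete B)
    (g : ∀ j, MVHom (F j).obj.carrier B) (f : limitCutHull (coproductGenerators F))
    (φ : MVHom B unitInterval) :
    φ.toFun ((coproductDesc hB g).toFun f) = f.1 fun j => φ.compHom (g j) :=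
  apply_limitCutHullLift hB _ _ f φ

/-- The coproduct cofan is a colimit. -/
noncomputable def isColimitCoproductCofan : IsColimit (coproductCofan F) :=
  Cofan.IsColimit.mk _
    (fun t => ObjectProperty.homMk (coproductDesc t.pt.property fun j => (t.inj j).hom))
    (fun t j => ObjectProperty.hom_ext _ <| MVHom.ext <| funext fun a =>
      t.pt.property.semisimple.hom_ext fun φ =>
        apply_coproductDesc t.pt.property _ ((coproductInjection F j).toFun a) φ)
    (fun t m hm => ObjectProperty.hom_ext _ <| MVHom.ext <| funext fun f =>
      t.pt.property.semisimple.hom_ext fun φ => by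
        refine (limitCutHull_hom_apply
          (fun φ j => φ.compHom (t.inj j).hom) (g := m.hom) ?_ f φ).trans
          (apply_coproductDesc t.pt.property (fun j => (t.inj j).hom) f φ).symm
        rintro _ ⟨j, a, rfl⟩ ψ
        exact congrArg (fun g => ψ.toFun (MVHom.toFun g.hom a)) (hm j))

end LccMVAlg

theorem corollary5p4 : CategoryTheory.Limits.HasCoproducts.{u} LccMVAlg.{u} :=
  hasCoproducts_of_colimit_cofans.{u} LccMVAlg.coproductCofan LccMVAlg.isColimitCoproductCofan
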